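/- Let $\Sigma$ be a finite alphabet with $|\Sigma|\ge 2$. A nondeterministic finite automaton $\mathcal A=(Q,q_0,\delta,F,\Sigma)$ ($Q$ finite, $\delta:Q\times\Sigma\to 2^Q$), in which every state is reachable from the initial state $q_0$ and from every state some final state is reachable, is called \emph{Wheeler} with respect to a total order $\prec$ on $\Sigma$ if there is a total order $<$ on $Q$ with minimum $q_0$ such that $q_0$ has no incoming transition and, whenever $v_1\in\delta(u_1,a_1)$ and $v_2\in\delta(u_2,a_2)$: (i) $a_1\prec a_2$ implies $v_1<v_2$; (ii) $a_1=a_2$ and $u_1<u_2$ imply $v_1\le v_2$. A language is \emph{Wheeler} with respect to $\prec$ if it is recognized by such an automaton. A language is \emph{generalized Wheeler} (GW) if it is recognized by an automaton that is Wheeler with respect to some total order on $\Sigma$. The \emph{star-free} languages over $\Sigma$ form the smallest class of subsets of $\Sigma^*$ that contains $\emptyset$, $\{\varepsilon\}$ and $\{a\}$ for every $a\in\Sigma$ and is closed under union, concatenation and complement in $\Sigma^*$. \textbf{Proposition.} The set $\{\mathcal L\subseteq\Sigma^*: \mathcal L\text{ is GW}\}$ is a proper subset of $\{\mathcal L\subseteq\Sigma^*: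 \mathcal L\text{ is star-free}\}$. Moreover, for any two distinct letters $a,b\in\Sigma$, the language $a(aba)^*a+ba(aba)^*b$ is star-free, but it is not Wheeler with respect to any total order on $\Sigma$. -/

import Mathlib

open scoped Computability

namespace GenWheeler

universe u v

/-- The star-free languages over `α`: the smallest class of languages that contains `∅`, `{ε}` and
the one-letter languages and is closed under union, concatenation and complement in `α*`. -/
inductive IsStarFree {α : Type u} : Language α → Prop
  | empty : IsStarFree (0 : Language α)
  | epsilon : IsStarFree (1 : Language α)
  | letter (a : α) : IsStarFree ({[a]} : Language α)
  | union {L₁ L₂ : Language α} : IsStarFree L₁ → IsStarFree L₂ → IsStarFree (L₁ + L₂)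
  | concat {L₁ L₂ : Language α} : IsStarFree L₁ → IsStarFree L₂ → IsStarFree (L₁ * L₂)
  | compl {L : Language α} : IsStarFree L → IsStarFree Lᶜ

/-- `M` is an automaton with the single initial state `q₀` that is basic: every state is reachable
from `q₀`, and from every state some final state can be reached. -/
structure IsBasic {α : Type u} {Q : Type v} (M : NFA α Q) (q₀ : Q) : Prop where
  start_eq : M.start = {q₀}
  reachable : ∀ q : Q, ∃ w : List α, q ∈ M.evalFrom {q₀} w
  coreachable : ∀ q : Q, ∃ w : List α, ∃ f ∈ M.accept, f ∈ M.evalFrom {q} w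

/-- The order on `Q` is a Wheeler order for the automaton `M` with initial state `q₀`, with respect
to the order on the alphabet `α`. -/
structure IsWheelerOrder {α : Type u} {Q : Type v} [LinearOrder α] [LinearOrder Q]
    (M : NFA α Q) (q₀ : Q) : Prop where
  init_min : ∀ q : Q, q₀ ≤ q
  init_no_incoming : ∀ (u : Q) (a : α), q₀ ∉ M.step u a
  lt_of_label_lt : ∀ (u₁ u₂ v₁ v₂ : Q) (a₁ a₂ : α), v₁ ∈ M.step u₁ a₁ → v₂ ∈ M.step u₂ a₂ →
    a₁ < a₂ → v₁ < v₂
  le_of_source_lt : ∀ (u₁ u₂ v₁ v₂ : Q) (a : α), v₁ ∈ M.step u₁ a → v₂ ∈ M.step u₂ a →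
    u₁ < u₂ → v₁ ≤ v₂

/-- `M` is a Wheeler NFA with respect to the given order of the alphabet. -/
def IsWheelerNFA {α : Type u} {Q : Type v} (ordα : LinearOrder α) (M : NFA α Q) : Prop :=
  ∃ (q₀ : Q) (ordQ : LinearOrder Q),
    IsBasic M q₀ ∧ @IsWheelerOrder α Q ordα ordQ M q₀

/-- `L` is a Wheeler language with respect to the given order of the alphabet: it is recognized by
a Wheeler NFA with finitely many states. -/
def IsWheelerLanguage {α : Type u} (ordα : LinearOrder α) (L : Language α) : Prop :=
  ∃ (Q : Type) (_ : Finite Q) (M : NFA α Q), IsWheelerNFA ordα M ∧ M.accepts = L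

/-- `M` is a generalized Wheeler automaton: some order of the alphabet makes it Wheeler. -/
def IsGWNFA {α : Type u} {Q : Type v} (M : NFA α Q) : Prop :=
  ∃ ordα : LinearOrder α, IsWheelerNFA ordα M

/-- `L` is a generalized Wheeler language: some finite generalized Wheeler automaton
recognizes it. -/
def IsGW {α : Type u} (L : Language α) : Prop :=
  ∃ (Q : Type) (_ : Finite Q) (M : NFA α Q), IsGWNFA M ∧ M.accepts = L

/-- The language `a(aba)*a + ba(aba)*b`. -/
def witness {α : Type u} (a b : α) : Language α :=
  {[a]} * ({[a, b, a]} : Language α)∗ * {[a]} + {[b, a]} * ({[a, b, a]} : Language α)∗ * {[b]}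

end GenWheeler

/-!
Every Wheeler language is star-free because the transition monoid of a Wheeler automaton is
aperiodic, so that Schützenberger's theorem applies.

Aperiodicity: if `p < q` and a word `w` leads from `p` to `p'` and from `q` to `q'`, then `p' ≤ q'`
or each of `p'`, `q'` is reached from `p` as well as from `q`
(`IsWheelerOrder.le_or_mem_evalFrom`). Consider a path `p₀, p₁, p₂, …` each of whose steps reads
`w`. If `p₀ < p₁`, then `p₁ < p₂`, or `w` has a loop at `p₁` and also leads directly from `p₀` to
`p₂`; the case `p₀ > p₁` is symmetric. A long path cannot be strictly monotone, so it passes through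
a loop at which it can be prolonged by one step, and it can be shortened by one step
(`exists_predecessors_pow_succ_eq`). Hence `wⁿ` and `wⁿ⁺¹` induce the same relation on states for
large `n`.

Schützenberger's theorem (`isStarFree_fiber`) is proved with the local divisor technique of Diekert
and Kufleitner. Words are cut at the occurrences of a letter `c` whose value is not `1`. The pieces
are words over a smaller alphabet, and the sequence of the values of the pieces is a word that is
evaluated in the local divisor `cM ∩ Mc`, which is again aperiodic and is smaller than `M`.

The language `a(aba)*a + ba(aba)*b` is star-free because `aba` occurs in a power of `aba` only at
multiples of three, which describes `(aba)*` by a condition on the factor `aba`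
(`isStarFree_kstar_aba`). It is not Wheeler because its prefixes `a(aba)ⁿ` and `ba(aba)ⁿ` form an
infinite chain for the relation of being a suffix, whose consecutive members are inequivalent; such
a chain leads to an infinite strictly increasing sequence of states
(`not_isWheelerLanguage_witness`).
-/

namespace GenWheeler

/-! ### Closure properties of star-free languages -/

section StarFree

variable {α : Type*}

theorem IsStarFree.of_mem_iff {K L : Language α} (hK : IsStarFree K) (h : ∀ w, w ∈ L ↔ w ∈ K) :
    IsStarFree L := by
  rwa [Language.ext h]

theorem IsStarFree.inter {K L : Language α} (hK : IsStarFree K) (hL : IsStarFree L) :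
    IsStarFree {w | w ∈ K ∧ w ∈ L} := by
  refine (hK.compl.union hL.compl).compl.of_mem_iff fun w ↦ ?_
  change w ∈ K ∧ w ∈ L ↔ ¬ (w ∉ K ∨ w ∉ L)
  tauto

theorem IsStarFree.top : IsStarFree (⊤ : Language α) :=
  IsStarFree.empty.compl.of_mem_iff fun w ↦ by
    change True ↔ ¬ False
    tauto

theorem IsStarFree.biUnion_finset {ι : Type*} (s : Finset ι) {F : ι → Language α}
    (hF : ∀ i ∈ s, IsStarFree (F i)) : IsStarFree {w | ∃ i ∈ s, w ∈ F i} := by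
  classical
  induction s using Finset.induction_on with
  | empty =>
    refine IsStarFree.empty.of_mem_iff fun w ↦ ?_
    change (∃ i ∈ (∅ : Finset ι), w ∈ F i) ↔ False
    simp
  | insert i s hi ih =>
    refine ((hF i (by simp)).union (ih fun j hj ↦ hF j (by simp [hj]))).of_mem_iff fun w ↦ ?_
    change (∃ j ∈ insert i s, w ∈ F j) ↔ w ∈ F i ∨ ∃ j ∈ s, w ∈ F j
    simp

theorem IsStarFree.iUnion {ι : Type*} [Finite ι] {F : ι → Language α}
    (hF : ∀ i, IsStarFree (F i)) : IsStarFree {w | ∃ i, w ∈ F i} := by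
  have := Fintype.ofFinite ι
  simpa using IsStarFree.biUnion_finset Finset.univ fun i _ ↦ hF i

theorem IsStarFree.setOf_and {p : Prop} {L : Language α} (hL : IsStarFree L) :
    IsStarFree {w | p ∧ w ∈ L} := by
  by_cases hp : p
  · exact hL.of_mem_iff fun w ↦ and_iff_right hp
  · exact IsStarFree.empty.of_mem_iff fun w ↦ iff_of_false (fun h ↦ hp h.1) id

theorem IsStarFree.word (w : List α) : IsStarFree ({w} : Language α) := by
  induction w with
  | nil => exact IsStarFree.epsilon
  | cons a w ih =>
    refine ((IsStarFree.letter a).concat ih).of_mem_iff fun v ↦ ?_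
    constructor
    · rintro rfl
      exact ⟨[a], rfl, w, rfl, rfl⟩
    · rintro ⟨_, rfl, _, rfl, rfl⟩
      rfl

/-- The words over a subalphabet. -/
def wordsOver (B : Set α) : Language α := {w | ∀ x ∈ w, x ∈ B}

/-- The words over a subalphabet form a star-free language over the whole alphabet: they are the
words without a factor consisting of one of the missing letters. -/
theorem isStarFree_wordsOver [Finite α] (B : Set α) : IsStarFree (wordsOver B) := by
  have h : ∀ x, IsStarFree
      {w | x ∉ B ∧ w ∈ (⊤ * {[x]} * ⊤)} := fun x ↦
    ((IsStarFree.top.concat (IsStarFree.letter x)).concat IsStarFree.top).setOf_and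
  refine (IsStarFree.iUnion h).compl.of_mem_iff fun w ↦ ?_
  change (∀ x ∈ w, x ∈ B) ↔
    ¬ ∃ x, x ∉ B ∧ w ∈ (⊤ * {[x]} * ⊤)
  have key : ∀ x, w ∈ (⊤ * {[x]} * ⊤ : Language α) ↔ x ∈ w := by
    intro x
    rw [List.mem_iff_append]
    constructor
    · rintro ⟨_, ⟨u, -, _, rfl, rfl⟩, v, -, rfl⟩
      exact ⟨u, v, by simp⟩
    · rintro ⟨u, v, rfl⟩
      exact ⟨u ++ [x], ⟨u, trivial, [x], rfl, rfl⟩, v, trivial, by simp⟩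
  simp only [key]
  push Not
  exact forall_congr' fun x ↦ by tauto

end StarFree

/-! ### Local divisors of a monoid -/

section LocalDivisor

variable {M : Type*} [Monoid M]

/-- A monoid is aperiodic if the powers of each of its elements are eventually constant. -/
def IsAperiodic (M : Type*) [Monoid M] : Prop := ∀ x : M, ∃ n : ℕ, x ^ (n + 1) = x ^ n

/-- The local divisor of the monoid `M` at `c`: the set `cM ∩ Mc`, on which
`(x c) ∘ (c y) = x c y` defines a multiplication with unit `c`. -/
def LocalDivisor (c : M) : Type _ := {x : M // (∃ y, x = c * y) ∧ ∃ z, x = z * c}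

namespace LocalDivisor

variable {c : M}

instance [Finite M] : Finite (LocalDivisor c) := Subtype.finite

noncomputable instance : Mul (LocalDivisor c) where
  mul x y := ⟨x.1 * y.2.1.choose, by
    obtain ⟨x, ⟨x₁, hx₁⟩, x₂, hx₂⟩ := x
    have hy := y.2.1.choose_spec
    refine ⟨⟨x₁ * y.2.1.choose, by simp [hx₁, mul_assoc]⟩, ?_⟩
    obtain ⟨z, hz⟩ := y.2.2
    refine ⟨x₂ * z, ?_⟩
    simp only
    rw [mul_assoc, ← hz]
    conv_rhs => rw [hy]
    rw [hx₂, mul_assoc]⟩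

instance : One (LocalDivisor c) := ⟨⟨c, ⟨1, by simp⟩, ⟨1, by simp⟩⟩⟩

/-- The product does not depend on the factor of the left argument that multiplies `c`. -/
theorem coe_mul_of_left {x : LocalDivisor c} {z : M} (hz : x.1 = z * c) (y : LocalDivisor c) :
    (x * y).1 = z * y.1 := by
  change x.1 * y.2.1.choose = _
  rw [hz, mul_assoc, ← y.2.1.choose_spec]

/-- The product does not depend on the factor of the right argument that multiplies `c`. -/
theorem coe_mul_of_right (x : LocalDivisor c) {y : LocalDivisor c} {z : M} (hz : y.1 = c * z) :
    (x * y).1 = x.1 * z := by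
  obtain ⟨w, hw⟩ := x.2.2
  rw [coe_mul_of_left hw, hw, hz, mul_assoc]

noncomputable instance : Monoid (LocalDivisor c) where
  mul_assoc x y z := by
    obtain ⟨w, hw⟩ := z.2.1
    apply Subtype.ext
    obtain ⟨v, hv⟩ := x.2.2
    rw [coe_mul_of_right _ hw, coe_mul_of_left hv, coe_mul_of_left hv, coe_mul_of_right _ hw,
      mul_assoc]
  one_mul x := Subtype.ext (by rw [coe_mul_of_left (z := 1) (by simp; rfl), one_mul])
  mul_one x := Subtype.ext (by rw [coe_mul_of_right (z := 1) _ (by simp; rfl), mul_one])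

theorem coe_pow {x : LocalDivisor c} {y : M} (hy : x.1 = c * y) (n : ℕ) :
    (x ^ n).1 = c * y ^ n := by
  induction n with
  | zero => simp; rfl
  | succ n ih => rw [pow_succ, coe_mul_of_right _ hy, ih, pow_succ, mul_assoc]

theorem isAperiodic (h : IsAperiodic M) : IsAperiodic (LocalDivisor c) := by
  intro x
  obtain ⟨y, hy⟩ := x.2.1
  obtain ⟨n, hn⟩ := h y
  exact ⟨n, Subtype.ext (by rw [coe_pow hy, coe_pow hy, hn])⟩

/-- In an aperiodic monoid only the unit is invertible, hence the other local divisors miss `1`. -/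
theorem card_lt [Finite M] (h : IsAperiodic M) (hc : c ≠ 1) :
    Nat.card (LocalDivisor c) < Nat.card M := by
  refine Finite.card_subtype_lt (x := 1) ?_
  rintro ⟨⟨y, hy⟩, -⟩
  obtain ⟨n, hn⟩ := h c
  have hcy : c ^ n * y ^ n = 1 := pow_mul_pow_eq_one n hy.symm
  apply hc
  calc c = c * (c ^ n * y ^ n) := by rw [hcy, mul_one]
    _ = c ^ (n + 1) * y ^ n := by rw [pow_succ', mul_assoc]
    _ = 1 := by rw [hn, hcy]

end LocalDivisor

end LocalDivisor

/-! ### Words as sequences of blocks that end with a marker letter -/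

section Blocks

variable {α : Type*}

/-- The concatenation of the blocks `v c`, where `v` runs through the list `l`. -/
def joinBlocks (c : α) (l : List (List α)) : List α := (l.map (· ++ [c])).flatten

@[simp] theorem joinBlocks_nil (c : α) : joinBlocks c [] = [] := rfl

@[simp] theorem joinBlocks_cons (c : α) (v : List α) (l : List (List α)) :
    joinBlocks c (v :: l) = v ++ c :: joinBlocks c l := by
  simp [joinBlocks]

theorem joinBlocks_append (c : α) (l l' : List (List α)) :
    joinBlocks c (l ++ l') = joinBlocks c l ++ joinBlocks c l' := by
  simp [joinBlocks]

theorem append_cons_inj {c : α} {v v' r r' : List α} (hv : c ∉ v) (hv' : c ∉ v')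
    (h : v ++ c :: r = v' ++ c :: r') : v = v' ∧ r = r' := by
  induction v generalizing v' with
  | nil =>
    cases v' with
    | nil => simpa using h
    | cons x v' =>
      simp only [List.nil_append, List.cons_append, List.cons.injEq] at h
      simp [h.1] at hv'
  | cons x v ih =>
    cases v' with
    | nil =>
      simp only [List.nil_append, List.cons_append, List.cons.injEq] at h
      simp [h.1] at hv
    | cons x' v' =>
      simp only [List.cons_append, List.cons.injEq] at h
      simp only [List.mem_cons, not_or] at hv hv'
      obtain ⟨h₁, h₂⟩ := ih hv.2 hv'.2 h.2
      exact ⟨by rw [h.1, h₁], h₂⟩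

theorem joinBlocks_inj {c : α} {l l' : List (List α)} (hl : ∀ v ∈ l, c ∉ v)
    (hl' : ∀ v ∈ l', c ∉ v) (h : joinBlocks c l = joinBlocks c l') : l = l' := by
  induction l generalizing l' with
  | nil => cases l' with
    | nil => rfl
    | cons v' l' => simp at h
  | cons v l ih => cases l' with
    | nil => simp at h
    | cons v' l' =>
      rw [joinBlocks_cons, joinBlocks_cons] at h
      obtain ⟨h₁, h₂⟩ := append_cons_inj (hl v (by simp)) (hl' v' (by simp)) h
      rw [h₁, ih (fun w hw ↦ hl w (by simp [hw])) (fun w hw ↦ hl' w (by simp [hw])) h₂]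

theorem exists_joinBlocks_append (c : α) (w : List α) :
    ∃ l z, w = joinBlocks c l ++ z ∧ (∀ v ∈ l, c ∉ v) ∧ c ∉ z := by
  induction w with
  | nil => exact ⟨[], [], by simp⟩
  | cons x w ih =>
    obtain ⟨l, z, rfl, hl, hz⟩ := ih
    by_cases hx : x = c
    · exact ⟨[] :: l, z, by simp [hx], by simpa using hl, hz⟩
    · cases l with
      | nil => exact ⟨[], x :: z, by simp, by simp, by simp [hz, Ne.symm hx]⟩
      | cons v l =>
        refine ⟨(x :: v) :: l, z, by simp, ?_, hz⟩
        rw [List.forall_mem_cons] at hl ⊢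
        exact ⟨by simp [Ne.symm hx, hl.1], hl.2⟩

theorem mem_joinBlocks {c x : α} {l : List (List α)} {v : List α} (hv : v ∈ l) (hx : x ∈ v) :
    x ∈ joinBlocks c l := by
  simp only [joinBlocks, List.mem_flatten, List.mem_map]
  exact ⟨v ++ [c], ⟨v, hv, rfl⟩, by simp [hx]⟩

end Blocks

/-! ### Languages recognized by finite aperiodic monoids -/

section Schutzenberger

universe u

variable {α M : Type u} [Monoid M]

/-- The words over the subalphabet `B` whose value under the homomorphism extending `f` is `m`. -/
def fiber (f : α → M) (B : Finset α) (m : M) : Language α :=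
  {w | (∀ x ∈ w, x ∈ B) ∧ (w.map f).prod = m}

/-- The preimage of a language `K` over the alphabet `M` under the substitution that reads a word
`v₁ c v₂ c ⋯ vₖ c`, where the `vᵢ` are words over `B`, as the word `f(v₁) f(v₂) ⋯ f(vₖ)`. -/
def blockPreimage (f : α → M) (B : Finset α) (c : α) (K : Language M) : Language α :=
  {w | ∃ l : List (List α), (∀ v ∈ l, ∀ x ∈ v, x ∈ B) ∧ w = joinBlocks c l ∧
    l.map (fun v ↦ (v.map f).prod) ∈ K}

theorem isStarFree_blockPreimage [Finite α] {f : α → M} {B : Finset α} {c : α} (hc : c ∉ B)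
    (hB : ∀ m, IsStarFree (fiber f B m)) {K : Language M} (hK : IsStarFree K) :
    IsStarFree (blockPreimage f B c K) := by
  induction hK with
  | empty =>
    convert IsStarFree.empty
    ext w
    constructor
    · rintro ⟨l, -, -, h⟩
      exact h
    · exact False.elim
  | epsilon =>
    convert IsStarFree.epsilon
    ext w
    constructor
    · rintro ⟨l, -, rfl, h⟩
      cases List.map_eq_nil_iff.1 h
      rfl
    · rintro rfl
      exact ⟨[], by simp, rfl, rfl⟩
  | letter t =>
    convert (hB t).concat (IsStarFree.letter c)
    ext w
    constructor
    · rintro ⟨l, hl, rfl, h⟩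
      obtain ⟨v, rfl, rfl⟩ := List.map_eq_singleton_iff.1 h
      exact ⟨v, ⟨hl v (by simp), rfl⟩, [c], rfl, by simp⟩
    · rintro ⟨v, ⟨hv, rfl⟩, _, rfl, rfl⟩
      exact ⟨[v], by simpa using hv, by simp, rfl⟩
  | @union K₁ K₂ _ _ ih₁ ih₂ =>
    convert ih₁.union ih₂
    ext w
    constructor
    · rintro ⟨l, hl, rfl, h | h⟩
      exacts [Or.inl ⟨l, hl, rfl, h⟩, Or.inr ⟨l, hl, rfl, h⟩]
    · rintro (⟨l, hl, rfl, h⟩ | ⟨l, hl, rfl, h⟩)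
      exacts [⟨l, hl, rfl, Or.inl h⟩, ⟨l, hl, rfl, Or.inr h⟩]
  | @concat K₁ K₂ _ _ ih₁ ih₂ =>
    convert ih₁.concat ih₂
    ext w
    constructor
    · rintro ⟨l, hl, rfl, k₁, h₁, k₂, h₂, h⟩
      obtain ⟨l₁, l₂, rfl, rfl, rfl⟩ := List.map_eq_append_iff.1 h.symm
      simp only [List.mem_append] at hl
      exact ⟨_, ⟨l₁, fun v hv ↦ hl v (Or.inl hv), rfl, h₁⟩, _,
        ⟨l₂, fun v hv ↦ hl v (Or.inr hv), rfl, h₂⟩, (joinBlocks_append c l₁ l₂).symm⟩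
    · rintro ⟨_, ⟨l₁, hl₁, rfl, h₁⟩, _, ⟨l₂, hl₂, rfl, h₂⟩, rfl⟩
      refine ⟨l₁ ++ l₂, ?_, (joinBlocks_append c l₁ l₂).symm, ?_⟩
      · intro v hv
        rcases List.mem_append.1 hv with hv | hv
        exacts [hl₁ v hv, hl₂ v hv]
      · rw [List.map_append]
        exact ⟨_, h₁, _, h₂, rfl⟩
  | @compl K _ ih =>
    -- Within the domain of the substitution, `1 + (B ∪ {c})* c`, preimages commute with complements
    -- because the decomposition into blocks is unique.
    have hdom : IsStarFree (1 + wordsOver {x | x ∈ B ∨ x = c} * {[c]}) :=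
      IsStarFree.epsilon.union ((isStarFree_wordsOver _).concat (IsStarFree.letter c))
    refine (hdom.inter ih.compl).of_mem_iff fun w ↦ ?_
    constructor
    · rintro ⟨l, hl, rfl, h⟩
      refine ⟨?_, ?_⟩
      · rcases List.eq_nil_or_concat' l with rfl | ⟨l, v, rfl⟩
        · exact Or.inl rfl
        · refine Or.inr ⟨joinBlocks c l ++ v, ?_, [c], rfl, by simp [joinBlocks_append]⟩
          intro x hx
          simp only [joinBlocks, List.mem_append, List.mem_flatten, List.mem_map] at hx
          rcases hx with ⟨_, ⟨u, hu, rfl⟩, hx⟩ | hx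
          · rcases List.mem_append.1 hx with hx | hx
            · exact Or.inl (hl u (by simp [hu]) x hx)
            · exact Or.inr (by simpa using hx)
          · exact Or.inl (hl v (by simp) x hx)
      · rintro ⟨l', hl', hll', h'⟩
        rw [joinBlocks_inj (fun v hv hcv ↦ hc (hl v hv c hcv))
          (fun v hv hcv ↦ hc (hl' v hv c hcv)) hll'] at h
        exact h h'
    · rintro ⟨hw, hK⟩
      have : ∃ l : List (List α), (∀ v ∈ l, ∀ x ∈ v, x ∈ B) ∧ w = joinBlocks c l := by
        rcases hw with rfl | ⟨v, hv, _, rfl, rfl⟩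
        · exact ⟨[], by simp, rfl⟩
        · obtain ⟨l, z, rfl, hl, hz⟩ := exists_joinBlocks_append c v
          refine ⟨l ++ [z], ?_, by simp [joinBlocks_append]⟩
          intro u hu x hx
          rcases List.mem_append.1 hu with hu | hu
          · rcases hv x (List.mem_append_left _ (mem_joinBlocks hu hx)) with h | rfl
            exacts [h, (hl u hu hx).elim]
          · obtain rfl : u = z := by simpa using hu
            rcases hv x (List.mem_append_right _ hx) with h | rfl
            exacts [h, (hz hx).elim]
      obtain ⟨l, hl, rfl⟩ := this
      exact ⟨l, hl, rfl, fun h ↦ hK ⟨l, hl, rfl, h⟩⟩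

/-- The element `c t c` of the local divisor at `c`. -/
def LocalDivisor.sandwich (c t : M) : LocalDivisor c :=
  ⟨c * t * c, ⟨t * c, by rw [mul_assoc]⟩, c * t, rfl⟩

/-- Evaluating a word of blocks in `M` amounts to evaluating in the local divisor at `f c` the word
formed by the values of the blocks. -/
theorem prod_joinBlocks (f : α → M) (c : α) (l : List (List α)) :
    f c * ((joinBlocks c l).map f).prod =
      (((l.map fun v ↦ (v.map f).prod).map (LocalDivisor.sandwich (f c))).prod).1 := by
  induction l with
  | nil => simp; rfl
  | cons v l ih =>
    rw [List.map_cons, List.map_cons, List.prod_cons, LocalDivisor.coe_mul_of_left rfl, ← ih]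
    simp [mul_assoc]

/-- A word over `B` either avoids the letter `c ∈ B`, or it factors uniquely at the first and the
last occurrence of `c`; the middle part is evaluated in the local divisor at `f c`. -/
theorem mem_fiber_iff [DecidableEq α] (f : α → M) (B : Finset α) {c : α} (hc : c ∈ B) (m : M)
    (w : List α) : w ∈ fiber f B m ↔ w ∈ fiber f (B.erase c) m ∨
      ∃ i : M × LocalDivisor (f c) × M, i.1 * i.2.1.1 * i.2.2 = m ∧
        w ∈ fiber f (B.erase c) i.1 * {[c]} *
          blockPreimage f (B.erase c) c {t | (t.map (LocalDivisor.sandwich (f c))).prod = i.2.1} *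
          fiber f (B.erase c) i.2.2 := by
  constructor
  · rintro ⟨hw, rfl⟩
    obtain ⟨l, z, rfl, hl, hz⟩ := exists_joinBlocks_append c w
    have hz' : ∀ x ∈ z, x ∈ B.erase c := fun x hx ↦ Finset.mem_erase.2
      ⟨fun h ↦ hz (h ▸ hx), hw x (List.mem_append_right _ hx)⟩
    have hl' : ∀ v ∈ l, ∀ x ∈ v, x ∈ B.erase c := fun v hv x hx ↦ Finset.mem_erase.2
      ⟨fun h ↦ hl v hv (h ▸ hx), hw x (List.mem_append_left _ (mem_joinBlocks hv hx))⟩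
    cases l with
    | nil => exact Or.inl ⟨hz', by simp⟩
    | cons v l =>
      rw [List.forall_mem_cons] at hl'
      obtain ⟨y, hy⟩ : ∃ y, ((l.map fun v ↦ (v.map f).prod).map
        (LocalDivisor.sandwich (f c))).prod = y := ⟨_, rfl⟩
      have hly := prod_joinBlocks f c l
      rw [hy] at hly
      refine Or.inr ⟨⟨(v.map f).prod, y, (z.map f).prod⟩, ?_, _, ⟨_, ⟨v, ⟨hl'.1, rfl⟩, [c], rfl, rfl⟩,
        joinBlocks c l, ⟨l, hl'.2, rfl, hy⟩, rfl⟩, z, ⟨hz', rfl⟩, by simp⟩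
      change (v.map f).prod * y.1 * (z.map f).prod = _
      rw [← hly]
      simp [mul_assoc]
  · rintro (⟨hw, rfl⟩ | ⟨⟨m₁, y, m₂⟩, hm, _, ⟨_, ⟨v, ⟨hv, hvm⟩, _, rfl, rfl⟩, _, ⟨l, hl, rfl, hlm⟩,
      rfl⟩, z, ⟨hz, hzm⟩, rfl⟩)
    · exact ⟨fun x hx ↦ Finset.mem_of_mem_erase (hw x hx), rfl⟩
    · refine ⟨?_, ?_⟩
      · intro x hx
        simp only [joinBlocks, List.mem_append, List.mem_singleton, List.mem_flatten,
          List.mem_map] at hx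
        rcases hx with ((hx | rfl) | ⟨_, ⟨u, hu, rfl⟩, hx⟩) | hx
        · exact Finset.mem_of_mem_erase (hv x hx)
        · exact hc
        · rcases List.mem_append.1 hx with hx | hx
          · exact Finset.mem_of_mem_erase (hl u hu x hx)
          · rwa [List.mem_singleton.1 hx]
        · exact Finset.mem_of_mem_erase (hz x hx)
      · change (List.map _ _).prod = y at hlm
        dsimp only at hm hvm hzm
        rw [← hm, ← hvm, ← hzm, ← hlm, ← prod_joinBlocks]
        simp [mul_assoc]

/-- Schützenberger's theorem: a homomorphism to a finite aperiodic monoid has star-free fibers.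
The proof is by induction on the size of the monoid and on the size of the subalphabet `B`: if some
letter `c ∈ B` has a nontrivial value, the words are cut at the occurrences of `c`, which leaves
words over a smaller alphabet and a problem for the smaller local divisor. -/
theorem isStarFree_fiber [Finite α] [Finite M] (hM : IsAperiodic M) (f : α → M) (B : Finset α)
    (m : M) : IsStarFree (fiber f B m) := by
  classical
  induction hn : Nat.card M using Nat.strong_induction_on generalizing α M with
  | _ n ihM =>
  subst hn
  induction hk : B.card using Nat.strong_induction_on generalizing B m with
  | _ k ihB =>
  subst hk
  by_cases hB : ∀ c ∈ B, f c = 1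
  · refine (isStarFree_wordsOver (B : Set α)).setOf_and (p := 1 = m) |>.of_mem_iff fun w ↦ ?_
    change ((∀ x ∈ w, x ∈ B) ∧ (w.map f).prod = m) ↔ (1 = m ∧ ∀ x ∈ w, x ∈ B)
    rw [and_comm, and_congr_left_iff]
    intro hw
    rw [List.prod_eq_one fun y hy ↦ ?_]
    obtain ⟨x, hx, rfl⟩ := List.mem_map.1 hy
    exact hB x (hw x hx)
  · push Not at hB
    obtain ⟨c, hc, hfc⟩ := hB
    have ih : ∀ m, IsStarFree (fiber f (B.erase c) m) := fun m ↦
      ihB _ (Finset.card_erase_lt_of_mem hc) _ _ rfl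
    have hD : ∀ y : LocalDivisor (f c), IsStarFree
        ({t | (t.map (LocalDivisor.sandwich (f c))).prod = y} : Language M) := by
      intro y
      have := Fintype.ofFinite M
      refine (ihM _ (LocalDivisor.card_lt hM hfc) (LocalDivisor.isAperiodic hM)
        (LocalDivisor.sandwich (f c)) Finset.univ y rfl).of_mem_iff fun t ↦ ?_
      exact (and_iff_right fun x _ ↦ Finset.mem_univ x).symm
    refine ((ih m).union (IsStarFree.iUnion fun i ↦ ?_)).of_mem_iff (mem_fiber_iff f B hc m)
    exact (((((ih _).concat (IsStarFree.letter c)).concat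
      (isStarFree_blockPreimage (Finset.notMem_erase c B) ih (hD _))).concat (ih _)).setOf_and)

end Schutzenberger

/-! ### The language `a(aba)*a + ba(aba)*b` is star-free -/

section Witness

variable {α : Type*}

/-- The word `(aba)ⁿ`. -/
def abaPow (a b : α) : ℕ → List α
  | 0 => []
  | n + 1 => [a, b, a] ++ abaPow a b n

theorem mem_kstar_singleton_aba {a b : α} {w : List α} :
    w ∈ ({[a, b, a]} : Language α)∗ ↔ ∃ n, w = abaPow a b n := by
  rw [Language.mem_kstar]
  constructor
  · rintro ⟨l, rfl, hl⟩
    induction l with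
    | nil => exact ⟨0, rfl⟩
    | cons v l ih =>
      obtain ⟨n, hn⟩ := ih fun y hy ↦ hl y (by simp [hy])
      obtain rfl : v = [a, b, a] := hl v (by simp)
      exact ⟨n + 1, by rw [List.flatten_cons, hn, abaPow]⟩
  · rintro ⟨n, rfl⟩
    induction n with
    | zero => exact ⟨[], rfl, by simp⟩
    | succ n ih =>
      obtain ⟨l, hl, h⟩ := ih
      refine ⟨[a, b, a] :: l, by rw [List.flatten_cons, ← hl, abaPow], ?_⟩
      rw [List.forall_mem_cons]
      exact ⟨rfl, h⟩

/-- Since `aba` overlaps its powers only at multiples of three, every occurrence of `aba` in a power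
of `aba` is followed by a power of `aba`. -/
theorem eq_abaPow_of_append_eq {a b : α} (hab : a ≠ b) {n : ℕ} {x y : List α}
    (h : x ++ ([a, b, a] ++ y) = abaPow a b n) : ∃ k, y = abaPow a b k := by
  induction n generalizing x with
  | zero => simp [abaPow] at h
  | succ n ih =>
    match x with
    | [] => exact ⟨n, by simpa [abaPow] using h⟩
    | [p] =>
      simp only [abaPow, List.cons_append, List.nil_append, List.cons.injEq] at h
      exact (hab h.2.1).elim
    | [p, q] =>
      simp only [abaPow, List.cons_append, List.nil_append, List.cons.injEq] at h
      cases n with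
      | zero => simp [abaPow] at h
      | succ n =>
        simp only [abaPow, List.cons_append, List.nil_append, List.cons.injEq] at h
        exact (hab h.2.2.2.1.symm).elim
    | p :: q :: r :: x =>
      simp only [abaPow, List.cons_append, List.nil_append, List.cons.injEq] at h
      exact ih h.2.2.2

/-- The language `(aba)*` is star-free: a word belongs to it if and only if it is empty or starts
with `aba`, and the same is true of what follows each occurrence of the factor `aba`. -/
theorem isStarFree_kstar_aba {a b : α} (hab : a ≠ b) :
    IsStarFree (({[a, b, a]} : Language α)∗) := by
  have hE : IsStarFree (1 + {[a, b, a]} * ⊤ : Language α) :=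
    IsStarFree.epsilon.union ((IsStarFree.word _).concat IsStarFree.top)
  refine (hE.inter (IsStarFree.top.concat
    ((IsStarFree.word [a, b, a]).concat hE.compl)).compl).of_mem_iff fun w ↦ ?_
  rw [mem_kstar_singleton_aba]
  have hpow : ∀ n, abaPow a b n ∈ (1 + {[a, b, a]} * ⊤ : Language α) := by
    rintro (_ | n)
    exacts [Or.inl rfl, Or.inr ⟨_, rfl, abaPow a b n, trivial, rfl⟩]
  constructor
  · rintro ⟨n, rfl⟩
    refine ⟨hpow n, ?_⟩
    rintro ⟨x, -, _, ⟨_, rfl, y, hy, rfl⟩, h⟩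
    obtain ⟨k, rfl⟩ := eq_abaPow_of_append_eq hab h
    exact hy (hpow k)
  · rintro ⟨hw, h⟩
    induction hn : w.length using Nat.strong_induction_on generalizing w with
    | _ n ih =>
    subst hn
    rcases hw with rfl | ⟨_, rfl, v, -, rfl⟩
    · exact ⟨0, rfl⟩
    · have hv : v ∈ (1 + {[a, b, a]} * ⊤ : Language α) := by
        by_contra hv
        exact h ⟨[], trivial, _, ⟨_, rfl, v, hv, rfl⟩, rfl⟩
      obtain ⟨n, rfl⟩ := ih v.length (by simp; omega) v hv (by
        rintro ⟨x, -, y, hy, rfl⟩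
        exact h ⟨[a, b, a] ++ x, trivial, y, hy, by simp⟩) rfl
      exact ⟨n + 1, rfl⟩

theorem isStarFree_witness {a b : α} (hab : a ≠ b) : IsStarFree (witness a b) :=
  (((IsStarFree.word _).concat (isStarFree_kstar_aba hab)).concat (IsStarFree.word _)).union
    (((IsStarFree.word _).concat (isStarFree_kstar_aba hab)).concat (IsStarFree.word _))

theorem append_left_mem_witness (a b : α) (n : ℕ) :
    [a] ++ abaPow a b n ++ [a] ∈ witness a b :=
  Or.inl ⟨_, ⟨[a], rfl, _, mem_kstar_singleton_aba.2 ⟨n, rfl⟩, rfl⟩, [a], rfl, rfl⟩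

theorem append_right_mem_witness (a b : α) (n : ℕ) :
    [b, a] ++ abaPow a b n ++ [b] ∈ witness a b :=
  Or.inr ⟨_, ⟨[b, a], rfl, _, mem_kstar_singleton_aba.2 ⟨n, rfl⟩, rfl⟩, [b], rfl, rfl⟩

theorem append_left_notMem_witness {a b : α} (hab : a ≠ b) (n : ℕ) :
    [a] ++ abaPow a b n ++ [b] ∉ witness a b := by
  rintro (⟨_, ⟨_, rfl, u, -, rfl⟩, _, rfl, h⟩ | ⟨_, ⟨_, rfl, u, -, rfl⟩, _, rfl, h⟩)
  · have := (List.append_inj' h rfl).2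
    simp [hab] at this
  · simp [hab.symm] at h

theorem append_right_notMem_witness {a b : α} (hab : a ≠ b) (n : ℕ) :
    [b, a] ++ abaPow a b n ++ [a] ∉ witness a b := by
  rintro (⟨_, ⟨_, rfl, u, -, rfl⟩, _, rfl, h⟩ | ⟨_, ⟨_, rfl, u, -, rfl⟩, _, rfl, h⟩)
  · simp [hab] at h
  · have := (List.append_inj' h rfl).2
    simp [hab.symm] at this

end Witness

/-! ### Powers of relations on a finite set -/

section Predecessors

variable {Q : Type*}

/-- The action of a relation on sets of points, by taking predecessors. It turns composition of
relations into composition of functions, in the same order. -/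
def predecessors (r : Q → Q → Prop) : Function.End (Set Q) := fun S ↦ {p | ∃ q ∈ S, r p q}

theorem mem_predecessors_pow_succ {r : Q → Q → Prop} {n : ℕ} {S : Set Q} {p : Q} :
    p ∈ (predecessors r ^ (n + 1)) S ↔ ∃ q ∈ (predecessors r ^ n) S, r p q := by
  rw [pow_succ']
  rfl

variable {r lt : Q → Q → Prop} {ρ : Q → ℕ} {S : Set Q}

/-- If an ascending step of the relation is always followed by an ascending step, unless it can be
skipped and its target carries a loop, then a long enough path can be prolonged by one step after
an initial ascending step. -/
theorem mem_predecessors_pow_succ_of_ascending (hlt : ∀ p q, lt p q → ρ q < ρ p)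
    (h : ∀ p q s, r p q → r q s → lt p q → lt q s ∨ (r p s ∧ r q q)) {k : ℕ} {p q : Q}
    (hpq : r p q) (hp : lt p q) (hk : ρ q < k) (hq : q ∈ (predecessors r ^ k) S) :
    q ∈ (predecessors r ^ (k + 1)) S := by
  induction k generalizing p q with
  | zero => omega
  | succ k ih =>
    obtain ⟨s, hs, hqs⟩ := mem_predecessors_pow_succ.1 hq
    refine mem_predecessors_pow_succ.2 ?_
    rcases h p q s hpq hqs hp with hlt' | ⟨-, hqq⟩
    · exact ⟨s, ih hqs hlt' (by have := hlt _ _ hlt'; omega) hs, hqs⟩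
    · exact ⟨q, hq, hqq⟩

/-- Under the same condition, a long enough path with an initial ascending step can be shortened by
one step. -/
theorem mem_predecessors_pow_of_ascending (hlt : ∀ p q, lt p q → ρ q < ρ p)
    (h : ∀ p q s, r p q → r q s → lt p q → lt q s ∨ (r p s ∧ r q q)) {k : ℕ} {p q : Q}
    (hpq : r p q) (hp : lt p q) (hk : ρ q < k) (hq : q ∈ (predecessors r ^ k) S) :
    p ∈ (predecessors r ^ k) S := by
  induction k generalizing p q with
  | zero => omega
  | succ k ih =>
    obtain ⟨s, hs, hqs⟩ := mem_predecessors_pow_succ.1 hq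
    refine mem_predecessors_pow_succ.2 ?_
    rcases h p q s hpq hqs hp with hlt' | ⟨hps, -⟩
    · exact ⟨q, ih hqs hlt' (by have := hlt _ _ hlt'; omega) hs, hpq⟩
    · exact ⟨s, hs, hps⟩

/-- A relation on a finite linear order has eventually constant powers if it is monotone up to
exchanging targets: a long path that is neither ascending nor descending has a loop that can be
repeated or omitted. -/
theorem exists_predecessors_pow_succ_eq [Finite Q] [LinearOrder Q]
    (h : ∀ p q p' q', p < q → r p p' → r q q' → p' ≤ q' ∨ (r p q' ∧ r q p')) :
    ∃ n, predecessors r ^ (n + 1) = predecessors r ^ n := by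
  have hup : ∀ p q : Q, p < q → (Set.Ioi q).ncard < (Set.Ioi p).ncard := fun p q hpq ↦
    Set.ncard_lt_ncard (Set.Ioi_ssubset_Ioi hpq)
  have hdown : ∀ p q : Q, q < p → (Set.Iio q).ncard < (Set.Iio p).ncard := fun p q hpq ↦
    Set.ncard_lt_ncard (Set.Iio_ssubset_Iio hpq)
  have hup' : ∀ p q s : Q, r p q → r q s → p < q → q < s ∨ (r p s ∧ r q q) := by
    intro p q s hpq hqs hp
    rcases h p q q s hp hpq hqs with hle | hr
    · rcases hle.lt_or_eq with hlt | rfl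
      exacts [Or.inl hlt, Or.inr ⟨hpq, hqs⟩]
    · exact Or.inr hr
  have hdown' : ∀ p q s : Q, r p q → r q s → q < p → s < q ∨ (r p s ∧ r q q) := by
    intro p q s hpq hqs hp
    rcases h q p s q hp hqs hpq with hle | hr
    · rcases hle.lt_or_eq with hlt | rfl
      exacts [Or.inl hlt, Or.inr ⟨hpq, hqs⟩]
    · exact Or.inr hr.symm
  have hup_card : ∀ q : Q, (Set.Ioi q).ncard ≤ Nat.card Q := fun q ↦ Set.ncard_le_card _
  have hdown_card : ∀ q : Q, (Set.Iio q).ncard ≤ Nat.card Q := fun q ↦ Set.ncard_le_card _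
  refine ⟨Nat.card Q + 2, funext fun S ↦ Set.ext fun p ↦ ⟨fun hp ↦ ?_, fun hp ↦ ?_⟩⟩
  · obtain ⟨q, hq, hpq⟩ := mem_predecessors_pow_succ.1 hp
    rcases lt_trichotomy p q with hlt | rfl | hlt
    · exact mem_predecessors_pow_of_ascending (lt := (· < ·)) hup hup' hpq hlt
        (by have := hup_card q; omega) hq
    · exact hq
    · exact mem_predecessors_pow_of_ascending (lt := (· > ·)) hdown hdown' hpq hlt
        (by have := hdown_card q; omega) hq
  · obtain ⟨q, hq, hpq⟩ := mem_predecessors_pow_succ.1 hp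
    refine mem_predecessors_pow_succ.2 ⟨q, ?_, hpq⟩
    rcases lt_trichotomy p q with hlt | rfl | hlt
    · exact mem_predecessors_pow_succ_of_ascending (lt := (· < ·)) hup hup' hpq hlt
        (by have := hup_card q; omega) hq
    · exact hp
    · exact mem_predecessors_pow_succ_of_ascending (lt := (· > ·)) hdown hdown' hpq hlt
        (by have := hdown_card q; omega) hq

end Predecessors

/-! ### The action of words on a Wheeler automaton -/

section Wheeler

variable {α Q : Type*}

/-- The value of a word in the transition monoid, acting on sets of states by predecessors. -/
theorem prod_map_predecessors (M : NFA α Q) (w : List α) :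
    (w.map fun a ↦ predecessors fun p q ↦ q ∈ M.step p a).prod =
      predecessors fun p q ↦ q ∈ M.evalFrom {p} w := by
  induction w with
  | nil =>
    funext S
    ext p
    change p ∈ S ↔ ∃ q ∈ S, q ∈ M.evalFrom {p} []
    simp
  | cons a w ih =>
    rw [List.map_cons, List.prod_cons, ih]
    funext S
    ext p
    change (∃ s, (∃ q ∈ S, q ∈ M.evalFrom {s} w) ∧ s ∈ M.step p a) ↔
      ∃ q ∈ S, q ∈ M.evalFrom {p} (a :: w)
    simp only [NFA.evalFrom_cons, NFA.stepSet_singleton,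
      NFA.mem_evalFrom_iff_exists (S := M.step p a)]
    constructor
    · rintro ⟨s, ⟨q, hq, hqs⟩, hs⟩
      exact ⟨q, hq, s, hs, hqs⟩
    · rintro ⟨q, hq, s, hs, hqs⟩
      exact ⟨s, ⟨q, hq, hqs⟩, hs⟩

/-- Words act monotonically on sets of states of a Wheeler automaton: two states reached by the same
word from `S < T` are in the same order, unless both are reached from `S` as well as from `T`. -/
theorem IsWheelerOrder.le_or_mem_evalFrom [LinearOrder α] [LinearOrder Q] {M : NFA α Q} {q₀ : Q}
    (hM : IsWheelerOrder M q₀) {S T : Set Q} (hST : ∀ p ∈ S, ∀ q ∈ T, p < q) {w : List α} {p q : Q}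
    (hp : p ∈ M.evalFrom S w) (hq : q ∈ M.evalFrom T w) :
    p ≤ q ∨ (q ∈ M.evalFrom S w ∧ p ∈ M.evalFrom T w) := by
  induction w using List.reverseRecOn generalizing p q with
  | nil => exact Or.inl (hST p hp q hq).le
  | append_singleton w a ih =>
    simp only [NFA.evalFrom_append, NFA.evalFrom_singleton, NFA.mem_stepSet] at hp hq ⊢
    obtain ⟨p', hp', hp⟩ := hp
    obtain ⟨q', hq', hq⟩ := hq
    rcases ih hp' hq' with hle | ⟨h₁, h₂⟩
    · rcases hle.lt_or_eq with hlt | rfl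
      · exact Or.inl (hM.le_of_source_lt _ _ _ _ _ hp hq hlt)
      · exact Or.inr ⟨⟨p', hp', hq⟩, p', hq', hp⟩
    · exact Or.inr ⟨⟨q', h₁, hq⟩, p', h₂, hp⟩

/-- A state reached from the initial state by a word lies strictly below every state that is reached
by a longer word with this suffix but not by the word itself. -/
theorem IsWheelerOrder.lt_of_mem_evalFrom_append [LinearOrder α] [LinearOrder Q] {M : NFA α Q}
    {q₀ : Q} (hM : IsWheelerOrder M q₀) {z w : List α} (hz : z ≠ []) {p q : Q}
    (hp : p ∈ M.evalFrom {q₀} w) (hq : q ∈ M.evalFrom {q₀} (z ++ w))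
    (hqw : q ∉ M.evalFrom {q₀} w) : p < q := by
  have hST : ∀ s ∈ ({q₀} : Set Q), ∀ t ∈ M.evalFrom {q₀} z, s < t := by
    rintro _ rfl t ht
    refine (hM.init_min t).lt_of_ne ?_
    rintro rfl
    rcases List.eq_nil_or_concat' z with rfl | ⟨z, a, rfl⟩
    · exact hz rfl
    · rw [NFA.evalFrom_append, NFA.evalFrom_singleton, NFA.mem_stepSet] at ht
      obtain ⟨u, -, hu⟩ := ht
      exact hM.init_no_incoming u a hu
  rw [NFA.evalFrom_append] at hq
  rcases hM.le_or_mem_evalFrom hST hp hq with hle | h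
  · refine hle.lt_of_ne ?_
    rintro rfl
    exact hqw hp
  · exact (hqw h.1).elim

/-- The language of a finite Wheeler automaton is star-free, since its transition monoid is
aperiodic. -/
theorem IsWheelerOrder.isStarFree_accepts {α : Type*} [Finite α] {Q : Type} [Finite Q]
    [LinearOrder α] [LinearOrder Q] {M : NFA α Q} {q₀ : Q} (hM : IsWheelerOrder M q₀)
    (hstart : M.start = {q₀}) : IsStarFree M.accepts := by
  let g : α → Function.End (Set Q) := fun a ↦ predecessors fun p q ↦ q ∈ M.step p a
  let N := MonoidHom.mrange (FreeMonoid.lift g)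
  have hN : IsAperiodic N := by
    rintro ⟨_, w, rfl⟩
    have hw : FreeMonoid.lift g w =
        predecessors fun p q ↦ q ∈ M.evalFrom {p} w.toList := by
      rw [← prod_map_predecessors, FreeMonoid.lift_apply]
    obtain ⟨n, hn⟩ := exists_predecessors_pow_succ_eq
      (r := fun p q ↦ q ∈ M.evalFrom {p} w.toList) fun p q p' q' hpq hp hq ↦
        hM.le_or_mem_evalFrom (by rintro _ rfl _ rfl; exact hpq) hp hq
    exact ⟨n, Subtype.ext (by simp only [SubmonoidClass.coe_pow, hw, hn])⟩
  -- The fibers are taken in a copy of the transition monoid in the universe of the alphabet.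
  let f : α → ULift N := fun a ↦ ⟨g a, FreeMonoid.of a, FreeMonoid.lift_eval_of g a⟩
  have hf : ∀ w : List α, ((w.map f).prod.down : Function.End (Set Q)) =
      predecessors fun p q ↦ q ∈ M.evalFrom {p} w := by
    intro w
    rw [← prod_map_predecessors]
    induction w with
    | nil => rfl
    | cons a w ih =>
      rw [List.map_cons, List.prod_cons, List.map_cons, List.prod_cons, ← ih]
      rfl
  have hN' : IsAperiodic (ULift N) := by
    rintro ⟨x⟩
    obtain ⟨n, hn⟩ := hN x
    exact ⟨n, ULift.ext _ _ hn⟩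
  have := Fintype.ofFinite α
  have : Finite (Function.End (Set Q)) := inferInstanceAs (Finite (Set Q → Set Q))
  have : Finite N := Subtype.finite
  refine (IsStarFree.iUnion fun m : ULift N ↦ (isStarFree_fiber hN' f Finset.univ m).setOf_and
    (p := q₀ ∈ (m.down : Function.End (Set Q)) M.accept)).of_mem_iff fun w ↦ ?_
  have haccept : w ∈ M.accepts ↔ q₀ ∈ ((w.map f).prod.down : Function.End (Set Q)) M.accept := by
    rw [hf, NFA.mem_accepts, hstart]
    rfl
  rw [haccept]
  constructor
  · exact fun h ↦ ⟨(w.map f).prod, h, fun x _ ↦ Finset.mem_univ x, rfl⟩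
  · rintro ⟨_, h, -, rfl⟩
    exact h

/-- The prefixes `a(aba)ⁿ` and `ba(aba)ⁿ` of words of the language are not equivalent, while each of
`a(aba)ⁿ`, `ba(aba)ⁿ`, `a(aba)ⁿ⁺¹` is a suffix of the next one. Hence they lead to strictly
increasing states of a Wheeler automaton, for every order of the alphabet. -/
theorem not_isWheelerLanguage_witness {a b : α} (hab : a ≠ b) (ordα : LinearOrder α) :
    ¬ IsWheelerLanguage ordα (witness a b) := by
  rintro ⟨Q, hQ, M, ⟨q₀, ordQ, hbasic, hM⟩, hL⟩
  have hacc : ∀ u z, u ++ z ∈ witness a b ↔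
      ∃ p ∈ M.evalFrom {q₀} u, z ∈ M.acceptsFrom {p} := by
    intro u z
    rw [← hL, NFA.mem_accepts, hbasic.start_eq]
    simp only [NFA.evalFrom_append, NFA.mem_acceptsFrom,
      NFA.mem_evalFrom_iff_exists (S := M.evalFrom {q₀} u)]
    exact ⟨fun ⟨s, hs, p, hp, h⟩ ↦ ⟨p, hp, s, hs, h⟩, fun ⟨p, hp, s, hs, h⟩ ↦ ⟨s, hs, p, hp, h⟩⟩
  choose p hp hpa using fun n ↦ (hacc _ _).1 (append_left_mem_witness a b n)
  choose q hq hqb using fun n ↦ (hacc _ _).1 (append_right_mem_witness a b n)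
  have hdisj : ∀ n s, s ∈ M.evalFrom {q₀} ([a] ++ abaPow a b n) → [b] ∉ M.acceptsFrom {s} :=
    fun n s hs h ↦ append_left_notMem_witness hab n ((hacc _ _).2 ⟨s, hs, h⟩)
  have hpq : ∀ n, p n < q n := fun n ↦
    hM.lt_of_mem_evalFrom_append (z := [b]) (by simp) (hp n) (hq n) fun h ↦ hdisj n _ h (hqb n)
  have hqp : ∀ n, q n < p (n + 1) := fun n ↦
    hM.lt_of_mem_evalFrom_append (z := [a, a]) (by simp) (hq n) (hp (n + 1)) fun h ↦
      append_right_notMem_witness hab n ((hacc _ _).2 ⟨_, h, hpa (n + 1)⟩)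
  exact not_injective_infinite_finite p
    (strictMono_nat_of_lt_succ fun n ↦ (hpq n).trans (hqp n)).injective

end Wheeler

end GenWheeler

theorem mainTheorem7 {α : Type*} [Finite α] (hα : 2 ≤ Nat.card α) :
    {L : Language α | GenWheeler.IsGW L} ⊂ {L : Language α | GenWheeler.IsStarFree L} ∧
    ∀ a b : α, a ≠ b →
      GenWheeler.IsStarFree (GenWheeler.witness a b) ∧
      ∀ ordα : LinearOrder α, ¬ GenWheeler.IsWheelerLanguage ordα (GenWheeler.witness a b) := by
  have hwitness : ∀ a b : α, a ≠ b → GenWheeler.IsStarFree (GenWheeler.witness a b) ∧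
      ∀ ordα : LinearOrder α, ¬ GenWheeler.IsWheelerLanguage ordα (GenWheeler.witness a b) :=
    fun a b hab ↦ ⟨GenWheeler.isStarFree_witness hab,
      GenWheeler.not_isWheelerLanguage_witness hab⟩
  refine ⟨⟨?_, fun hsub ↦ ?_⟩, hwitness⟩
  · rintro L ⟨Q, hQ, M, ⟨ordα, q₀, ordQ, hbasic, hM⟩, rfl⟩
    exact hM.isStarFree_accepts hbasic.start_eq
  · have : Nontrivial α := Finite.one_lt_card_iff_nontrivial.1 hα
    obtain ⟨a, b, hab⟩ := exists_pair_ne α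
    obtain ⟨hstar, hnot⟩ := hwitness a b hab
    obtain ⟨Q, hQ, M, ⟨ordα, hM⟩, hL⟩ := hsub hstar
    exact hnot ordα ⟨Q, hQ, M, hM, hL⟩
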